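/- Let $\mathcal{H}$ be a complex Hilbert space, let $U$ be a unitary operator on $\mathcal{H}$ and let $E(\cdot)$ be its spectral measure on the unit circle $\mathbb{T}$, i.e. the unique countably additive function from the Borel subsets of $\mathbb{T}$ to the orthogonal projections of $\mathcal{H}$ with $E(\mathbb{T})=I$ and $U=\int \xi\,dE(\xi)$. For $x\in\mathcal{H}$ let $\mu_x(\Omega)=\langle E(\Omega)x,x\rangle$. For a finite positive Borel measure $\mu$ on $\mathbb{T}$ put $\mathcal{H}_\mu=\{x\in\mathcal{H}:\mu_x\ll\mu\}$, which is a closed subspace of $\mathcal{H}$, and let $\mu^c$ be the measure $\mu^c(\Omega)=\mu(\{\overline{\xi}:\xi\in\Omega\})$. Let $\mathscr{C}_c(U)$ be the set of all bounded antilinear maps $C:\mathcal{H}\to\mathcal{H}$ that are isometric ($\|Cx\|=\|x\|$ for all $x$) and involutive ($C^2=I$) and satisfy $CUC=U$. Then for every finite positive Borel measure $\mu$ on $\mathbb{T}$ and every $C\in\mathscr{C}_c(U)$: (a) $C\mathcal{H}_\mu=\mathcal{H}_{\mu^c}$ and $C\mathcal{H}_\mu^\perp=\mathcal{H}_{\mu^c}^\perp$;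 (b) $\mathcal{H}=\mathcal{H}_\mu\oplus\mathcal{H}_\mu^\perp=\mathcal{H}_{\mu^c}\oplus\mathcal{H}_{\mu^c}^\perp$, and with respect to these decompositions $C=C_{\mu,\mu^c}\oplus C'_{\mu,\mu^c}$, where the restrictions $C_{\mu,\mu^c}=C|_{\mathcal{H}_\mu}:\mathcal{H}_\mu\to\mathcal{H}_{\mu^c}$ and $C'_{\mu,\mu^c}=C|_{\mathcal{H}_\mu^\perp}:\mathcal{H}_\mu^\perp\to\mathcal{H}_{\mu^c}^\perp$ are antilinear surjective isometries. -/

import Mathlib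

open MeasureTheory Filter Topology
open scoped InnerProductSpace

noncomputable instance : MeasurableSpace Circle := borel Circle
instance : BorelSpace Circle := ⟨rfl⟩

/-- A spectral measure on the unit circle: a countably additive (in the strong operator topology)
function `E` from the Borel subsets of the circle to the orthogonal projections of `H`, with
`E(𝕋) = I`. Off the Borel sets it has the value `0`, by convention. -/
structure SpectralMeasure (H : Type*) [NormedAddCommGroup H] [InnerProductSpace ℂ H]
    [CompleteSpace H] where
  proj : Set Circle → H →L[ℂ] H
  isStarProjection : ∀ Ω, MeasurableSet Ω → IsStarProjection (proj Ω)
  not_measurable : ∀ Ω, ¬ MeasurableSet Ω → proj Ω = 0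
  empty : proj ∅ = 0
  univ : proj Set.univ = 1
  hasSum_iUnion : ∀ Ω : ℕ → Set Circle, (∀ n, MeasurableSet (Ω n)) →
    Pairwise (Function.onFun Disjoint Ω) →
    ∀ x, HasSum (fun n => proj (Ω n) x) (proj (⋃ n, Ω n) x)

section
variable {H : Type*} [NormedAddCommGroup H] [InnerProductSpace ℂ H] [CompleteSpace H]

theorem exists_circle_calculus (U : unitary (H →L[ℂ] H)) :
    ∃ φ : C(Circle, ℂ) →⋆ₐ[ℂ] (H →L[ℂ] H),
      φ ⟨fun ξ => (ξ : ℂ), by fun_prop⟩ = (U : H →L[ℂ] H) := by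
  have hn : IsStarNormal (U : H →L[ℂ] H) := inferInstance
  let j : C(spectrum ℂ (U : H →L[ℂ] H), Circle) :=
    ⟨fun z => ⟨z.1, Unitary.spectrum_subset_circle U z.2⟩,
      Continuous.subtype_mk continuous_subtype_val _⟩
  refine ⟨(cfcHom hn).comp (ContinuousMap.compStarAlgHom' ℂ ℂ j), ?_⟩
  exact cfcHom_id hn

/-- Real continuous functions seen as complex ones. -/
noncomputable def circleOfReal (f : C(Circle, ℝ)) : C(Circle, ℂ) := ⟨fun ξ => (f ξ : ℂ), by fun_prop⟩

theorem exists_circle_measure (φ : C(Circle, ℂ) →⋆ₐ[ℂ] (H →L[ℂ] H)) (x : H) :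
    ∃ ν : Measure Circle, IsFiniteMeasure ν ∧
      ∀ f : C(Circle, ℝ), ∫ ξ, f ξ ∂ν = (⟪x, φ (circleOfReal f) x⟫_ℂ).re := by
  let L : CompactlySupportedContinuousMap Circle ℝ →ₗ[ℝ] ℝ :=
    { toFun := fun f => (⟪x, φ (circleOfReal f.toContinuousMap) x⟫_ℂ).re
      map_add' := fun f g => by
        have : circleOfReal (f + g).toContinuousMap
            = circleOfReal f.toContinuousMap + circleOfReal g.toContinuousMap := by
          ext ξ; simp [circleOfReal]
        rw [this, map_add]
        simp
      map_smul' := fun c f => by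
        have : circleOfReal (c • f).toContinuousMap
            = (c : ℂ) • circleOfReal f.toContinuousMap := by
          ext ξ; simp [circleOfReal]
        rw [this, map_smul]
        simp }
  let Λ : CompactlySupportedContinuousMap Circle ℝ →ₚ[ℝ] ℝ :=
    PositiveLinearMap.mk₀ L (by
      intro f hf
      let g : C(Circle, ℝ) := ⟨fun ξ => √(f ξ), by fun_prop⟩
      have hg : circleOfReal f.toContinuousMap = star (circleOfReal g) * circleOfReal g := by
        ext ξ
        have h0 : 0 ≤ f ξ := hf ξ
        have := Real.mul_self_sqrt h0
        simp only [circleOfReal, ContinuousMap.coe_mk, ContinuousMap.mul_apply,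
          ContinuousMap.star_apply, g, RCLike.star_def, Complex.conj_ofReal]
        rw [← Complex.ofReal_mul, this]
        rfl
      change 0 ≤ (⟪x, φ (circleOfReal f.toContinuousMap) x⟫_ℂ).re
      rw [hg, map_mul, map_star, ContinuousLinearMap.star_eq_adjoint]
      rw [mul_apply_eq_comp, ContinuousLinearMap.adjoint_inner_right]
      exact inner_self_nonneg (𝕜 := ℂ))
  refine ⟨RealRMK.rieszMeasure Λ, inferInstance, fun f => ?_⟩
  exact RealRMK.integral_rieszMeasure Λ ⟨f, HasCompactSupport.of_compactSpace _⟩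

theorem exists_starProjection_of_tendsto (T : ℕ → H →L[ℂ] H) (hT : ∀ n, IsSelfAdjoint (T n))
    (hc : ∀ x, CauchySeq fun n => T n x) (c : H → ℝ)
    (h1 : ∀ x, Tendsto (fun n => ⟪x, T n x⟫_ℂ) atTop (𝓝 (c x : ℂ)))
    (h2 : ∀ x, Tendsto (fun n => ‖T n x‖ ^ 2) atTop (𝓝 (c x))) :
    ∃ P : H →L[ℂ] H, IsStarProjection P ∧ ∀ x, ⟪x, P x⟫_ℂ = (c x : ℂ) := by
  choose f hf using fun x => cauchySeq_tendsto_of_complete (hc x)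
  let P : H →L[ℂ] H := continuousLinearMapOfTendsto T (tendsto_pi_nhds.2 hf)
  have hP : ∀ x, Tendsto (fun n => T n x) atTop (𝓝 (P x)) := hf
  have hin : ∀ x, ⟪x, P x⟫_ℂ = (c x : ℂ) := fun x =>
    tendsto_nhds_unique (tendsto_const_nhds.inner (hP x)) (h1 x)
  have hno : ∀ x, ‖P x‖ ^ 2 = c x := fun x =>
    tendsto_nhds_unique ((hP x).norm.pow 2) (h2 x)
  have hsa : IsSelfAdjoint P := by
    rw [ContinuousLinearMap.isSelfAdjoint_iff_isSymmetric]
    intro x y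
    refine tendsto_nhds_unique ((hP x).inner (tendsto_const_nhds (x := y))) ?_
    have := (tendsto_const_nhds (x := x)).inner (𝕜 := ℂ) (hP y)
    refine this.congr fun n => ?_
    exact ((ContinuousLinearMap.isSelfAdjoint_iff_isSymmetric.1 (hT n)) x y).symm
  refine ⟨P, ⟨?_, hsa⟩, hin⟩
  have : (P * P - P : H →L[ℂ] H) = 0 := by
    rw [← ContinuousLinearMap.coe_inj]
    refine (inner_map_self_eq_zero _).1 fun x => ?_
    have h3 : ⟪P (P x), x⟫_ℂ = ⟪P x, P x⟫_ℂ :=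
      (ContinuousLinearMap.isSelfAdjoint_iff_isSymmetric.1 hsa) (P x) x
    have h4 : ⟪P x, x⟫_ℂ = ⟪x, P x⟫_ℂ :=
      (ContinuousLinearMap.isSelfAdjoint_iff_isSymmetric.1 hsa) x x
    change ⟪P (P x) - P x, x⟫_ℂ = 0
    rw [inner_sub_left, h3, h4, hin, inner_self_eq_norm_sq_to_K, ← hno]
    simp
  exact sub_eq_zero.1 this

theorem starProjection_inner_eq {P : H →L[ℂ] H} (hP : IsStarProjection P) (x : H) :
    ⟪x, P x⟫_ℂ = ((‖P x‖ ^ 2 : ℝ) : ℂ) := by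
  have h3 : ⟪P x, P x⟫_ℂ = ⟪x, P (P x)⟫_ℂ :=
    (ContinuousLinearMap.isSelfAdjoint_iff_isSymmetric.1 hP.isSelfAdjoint) x (P x)
  have h4 : P (P x) = P x := congrArg (fun A : H →L[ℂ] H => A x) hP.isIdempotentElem.eq
  rw [h4, inner_self_eq_norm_sq_to_K] at h3
  rw [← h3]; simp

theorem clm_ext_of_inner_self {P Q : H →L[ℂ] H} (h : ∀ x, ⟪x, P x⟫_ℂ = ⟪x, Q x⟫_ℂ) :
    P = Q := by
  have : (P - Q : H →L[ℂ] H) = 0 := by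
    rw [← ContinuousLinearMap.coe_inj]
    refine (inner_map_self_eq_zero _).1 fun x => ?_
    change ⟪P x - Q x, x⟫_ℂ = 0
    rw [← inner_conj_symm, inner_sub_right, h, sub_self, map_zero]
  exact sub_eq_zero.1 this

theorem circle_calculus_selfAdjoint (φ : C(Circle, ℂ) →⋆ₐ[ℂ] (H →L[ℂ] H)) (f : C(Circle, ℝ)) :
    IsSelfAdjoint (φ (circleOfReal f)) := by
  have : IsSelfAdjoint (circleOfReal f) := by
    ext ξ; simp [circleOfReal]
  exact this.map φ

theorem circle_calculus_inner (φ : C(Circle, ℂ) →⋆ₐ[ℂ] (H →L[ℂ] H)) (x : H) {ν : Measure Circle}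
    (hν : ∀ f : C(Circle, ℝ), ∫ ξ, f ξ ∂ν = (⟪x, φ (circleOfReal f) x⟫_ℂ).re)
    (f : C(Circle, ℝ)) : ⟪x, φ (circleOfReal f) x⟫_ℂ = ((∫ ξ, f ξ ∂ν : ℝ) : ℂ) := by
  rw [hν]
  refine (Complex.conj_eq_iff_re.1 ?_).symm
  rw [inner_conj_symm]
  exact (ContinuousLinearMap.isSelfAdjoint_iff_isSymmetric.1
    (circle_calculus_selfAdjoint φ f)) x x

theorem circle_calculus_norm (φ : C(Circle, ℂ) →⋆ₐ[ℂ] (H →L[ℂ] H)) (x : H) {ν : Measure Circle}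
    (hν : ∀ f : C(Circle, ℝ), ∫ ξ, f ξ ∂ν = (⟪x, φ (circleOfReal f) x⟫_ℂ).re)
    (f : C(Circle, ℝ)) : ‖φ (circleOfReal f) x‖ ^ 2 = ∫ ξ, f ξ ^ 2 ∂ν := by
  have h : circleOfReal (f ^ 2) = circleOfReal f * circleOfReal f := by
    ext ξ; simp [circleOfReal, sq]
  have h2 := hν (f ^ 2)
  have e : ⟪φ (circleOfReal f) x, φ (circleOfReal f) x⟫_ℂ
      = ⟪x, φ (circleOfReal f) (φ (circleOfReal f) x)⟫_ℂ :=
    (ContinuousLinearMap.isSelfAdjoint_iff_isSymmetric.1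
      (circle_calculus_selfAdjoint φ f)) x (φ (circleOfReal f) x)
  rw [h, map_mul, mul_apply_eq_comp, ← e] at h2
  have h3 := inner_self_eq_norm_sq (𝕜 := ℂ) (φ (circleOfReal f) x)
  rw [← h3]
  exact h2.symm

/-- The projection of a closed set. -/
theorem exists_proj_of_isClosed (φ : C(Circle, ℂ) →⋆ₐ[ℂ] (H →L[ℂ] H)) (ν : H → Measure Circle)
    (hfin : ∀ x, IsFiniteMeasure (ν x))
    (hν : ∀ x, ∀ f : C(Circle, ℝ), ∫ ξ, f ξ ∂(ν x) = (⟪x, φ (circleOfReal f) x⟫_ℂ).re)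
    {K : Set Circle} (hK : IsClosed K) :
    ∃ P : H →L[ℂ] H, IsStarProjection P ∧ ∀ x, ⟪x, P x⟫_ℂ = ((ν x).real K : ℂ) := by
  have hδ : ∀ n : ℕ, (0 : ℝ) < 1 / ((n : ℝ) + 1) := fun n => Nat.one_div_pos_of_nat
  let g : ℕ → C(Circle, ℝ) := fun n =>
    ⟨fun ξ => (thickenedIndicator (hδ n) K ξ : ℝ), by fun_prop⟩
  let i : Circle → ℝ := K.indicator fun _ => 1
  have hg0 : ∀ n ξ, 0 ≤ g n ξ := fun n ξ => NNReal.coe_nonneg _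
  have hg1 : ∀ n ξ, g n ξ ≤ 1 := fun n ξ => NNReal.coe_le_one.2 (thickenedIndicator_le_one _ _ _)
  have hgi : ∀ ξ, Tendsto (fun n => g n ξ) atTop (𝓝 (i ξ)) := by
    intro ξ
    have h := thickenedIndicator_tendsto_indicator_closure hδ
      tendsto_one_div_add_atTop_nhds_zero_nat K
    rw [hK.closure_eq] at h
    have h2 := (NNReal.continuous_coe.tendsto _).comp (tendsto_pi_nhds.1 h ξ)
    have h3 : ((K.indicator (fun _ => (1 : NNReal)) ξ : NNReal) : ℝ) = i ξ := by
      by_cases hξ : ξ ∈ K <;> simp [i, hξ]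
    rw [← h3]
    exact h2
  have hi2 : ∀ ξ, i ξ ^ 2 = i ξ := by
    intro ξ
    by_cases hξ : ξ ∈ K <;> simp [i, hξ]
  have hint : ∀ x, ∫ ξ, i ξ ∂(ν x) = (ν x).real K := fun x =>
    integral_indicator_one hK.measurableSet
  refine exists_starProjection_of_tendsto (fun n => φ (circleOfReal (g n)))
    (fun n => circle_calculus_selfAdjoint φ _) (fun x => ?_) (fun x => (ν x).real K)
    (fun x => ?_) (fun x => ?_)
  · have := hfin x
    rw [cauchySeq_iff_tendsto_dist_atTop_0]
    have key : ∀ p : ℕ × ℕ, dist (φ (circleOfReal (g p.1)) x) (φ (circleOfReal (g p.2)) x)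
        = √(∫ ξ, (g p.1 ξ - g p.2 ξ) ^ 2 ∂(ν x)) := by
      intro p
      have h := circle_calculus_norm φ x (hν x) (g p.1 - g p.2)
      have h' : circleOfReal (g p.1 - g p.2) = circleOfReal (g p.1) - circleOfReal (g p.2) := by
        ext ξ; simp [circleOfReal]
      rw [h', map_sub] at h
      rw [dist_eq_norm, ← Real.sqrt_sq (norm_nonneg _)]
      exact congrArg Real.sqrt h
    simp only [key]
    rw [← Real.sqrt_zero]
    refine (Real.continuous_sqrt.tendsto _).comp ?_
    have h0 : (0 : ℝ) = ∫ _ξ : Circle, (0 : ℝ) ∂(ν x) := by simp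
    rw [h0]
    refine tendsto_integral_filter_of_dominated_convergence (fun _ => 1)
      (Eventually.of_forall fun p =>
        (((g p.1).continuous.sub (g p.2).continuous).pow 2).aestronglyMeasurable)
      (Eventually.of_forall fun p => ae_of_all _ fun ξ => ?_) (integrable_const _)
      (ae_of_all _ fun ξ => ?_)
    · rw [Real.norm_of_nonneg (sq_nonneg _)]
      have a0 := hg0 p.1 ξ
      have a1 := hg1 p.1 ξ
      have b0 := hg0 p.2 ξ
      have b1 := hg1 p.2 ξ
      exact (sq_le_one_iff_abs_le_one _).2 (abs_le.2 ⟨by linarith, by linarith⟩)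
    · have t1 : Tendsto (fun p : ℕ × ℕ => g p.1 ξ) atTop (𝓝 (i ξ)) :=
        (hgi ξ).comp (by rw [← prod_atTop_atTop_eq]; exact tendsto_fst)
      have t2 : Tendsto (fun p : ℕ × ℕ => g p.2 ξ) atTop (𝓝 (i ξ)) :=
        (hgi ξ).comp (by rw [← prod_atTop_atTop_eq]; exact tendsto_snd)
      simpa using (t1.sub t2).pow 2
  · have := hfin x
    simp only [circle_calculus_inner φ x (hν x)]
    refine (Complex.continuous_ofReal.tendsto _).comp ?_
    rw [← hint]
    refine tendsto_integral_of_dominated_convergence (fun _ => 1)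
      (fun n => (g n).continuous.aestronglyMeasurable) (integrable_const _)
      (fun n => ae_of_all _ fun ξ => ?_) (ae_of_all _ hgi)
    rw [Real.norm_of_nonneg (hg0 n ξ)]; exact hg1 n ξ
  · have := hfin x
    simp only [circle_calculus_norm φ x (hν x)]
    rw [← hint]
    refine tendsto_integral_of_dominated_convergence (fun _ => 1)
      (fun n => ((g n).continuous.pow 2).aestronglyMeasurable) (integrable_const _)
      (fun n => ae_of_all _ fun ξ => ?_) (ae_of_all _ fun ξ => ?_)
    · rw [Real.norm_of_nonneg (sq_nonneg _)]
      exact pow_le_one₀ (hg0 n ξ) (hg1 n ξ)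
    · rw [← hi2]; exact (hgi ξ).pow 2

theorem hasSum_real_iUnion {ν : Measure Circle} [IsFiniteMeasure ν] {A : ℕ → Set Circle}
    (hdisj : Pairwise (Function.onFun Disjoint A)) (hA : ∀ i, MeasurableSet (A i)) :
    HasSum (fun k => ν.real (A k)) (ν.real (⋃ k, A k)) := by
  have h := measure_iUnion (μ := ν) hdisj hA
  have h1 : ∑' k, ν (A k) ≠ ⊤ := h ▸ measure_ne_top _ _
  have h2 := ENNReal.hasSum_toReal h1
  have h3 : ν.real (⋃ k, A k) = ∑' k, (ν (A k)).toReal := by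
    rw [measureReal_def, h, ENNReal.tsum_toReal_eq fun k => measure_ne_top _ _]
  rw [h3]
  exact h2

theorem exists_proj_of_measurable (φ : C(Circle, ℂ) →⋆ₐ[ℂ] (H →L[ℂ] H)) (ν : H → Measure Circle)
    (hfin : ∀ x, IsFiniteMeasure (ν x))
    (hν : ∀ x, ∀ f : C(Circle, ℝ), ∫ ξ, f ξ ∂(ν x) = (⟪x, φ (circleOfReal f) x⟫_ℂ).re)
    (Ω : Set Circle) (hΩ : MeasurableSet Ω) :
    ∃ P : H →L[ℂ] H, IsStarProjection P ∧ ∀ x, ⟪x, P x⟫_ℂ = ((ν x).real Ω : ℂ) := by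
  have hnorm : ∀ {P : H →L[ℂ] H} {A : Set Circle}, IsStarProjection P →
      (∀ x, ⟪x, P x⟫_ℂ = ((ν x).real A : ℂ)) → ∀ x, ‖P x‖ ^ 2 = (ν x).real A := by
    intro P A hP h x
    have := (starProjection_inner_eq hP x).symm.trans (h x)
    exact_mod_cast this
  have huniv : ∀ x, ⟪x, x⟫_ℂ = ((ν x).real Set.univ : ℂ) := by
    intro x
    have h := circle_calculus_inner φ x (hν x) 1
    have h1 : circleOfReal 1 = 1 := by ext ξ; simp [circleOfReal]
    rw [h1, map_one] at h
    simpa using h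
  induction Ω, hΩ using MeasurableSpace.induction_on_inter
    (borel_eq_generateFrom_isClosed (α := Circle)) isPiSystem_isClosed with
  | empty => exact ⟨0, .zero _, fun x => by simp⟩
  | basic K hK => exact exists_proj_of_isClosed φ ν hfin hν hK
  | compl A hA ih =>
    obtain ⟨P, hP, h⟩ := ih
    refine ⟨1 - P, hP.one_sub, fun x => ?_⟩
    have := hfin x
    change ⟪x, x - P x⟫_ℂ = _
    rw [inner_sub_right, h, huniv, measureReal_compl hA]
    simp
  | iUnion A hdisj hA ih =>
    choose P hP h using ih
    have horth : ∀ i j, i ≠ j → ∀ x, P j (P i x) = 0 := by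
      intro i j hij x
      have := hfin (P i x)
      have e1 := hnorm (hP i) (h i) (P i x)
      have e2 := hnorm (hP j) (h j) (P i x)
      have e3 : P i (P i x) = P i x :=
        congrArg (fun T : H →L[ℂ] H => T x) (hP i).isIdempotentElem.eq
      have e4 : ‖P i x‖ ^ 2 = (ν (P i x)).real Set.univ := by
        have := huniv (P i x)
        rw [inner_self_eq_norm_sq_to_K] at this
        exact Complex.ofReal_injective (by simpa using this)
      have e5 : (ν (P i x)).real (A i ∪ A j) = _ :=
        measureReal_union (hdisj hij) (hA j)
      have e6 : (ν (P i x)).real (A i ∪ A j) ≤ (ν (P i x)).real Set.univ :=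
        measureReal_mono (Set.subset_univ _)
      rw [e3] at e1
      have : ‖P j (P i x)‖ ^ 2 ≤ 0 := by linarith
      have := pow_eq_zero_iff (two_ne_zero) |>.1 (le_antisymm this (sq_nonneg _))
      exact norm_eq_zero.1 this
    have hS : ∀ s : Finset ℕ, IsStarProjection (∑ k ∈ s, P k) ∧
        ∀ x, ⟪x, (∑ k ∈ s, P k) x⟫_ℂ = ((∑ k ∈ s, (ν x).real (A k) : ℝ) : ℂ) := by
      intro s
      refine ⟨⟨?_, ?_⟩, fun x => ?_⟩
      · ext x
        simp only [mul_apply_eq_comp, sum_apply, map_sum]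
        refine Finset.sum_congr rfl fun j hj => ?_
        rw [Finset.sum_eq_single j (fun i _ hij => horth j i hij.symm x) (fun hn => absurd hj hn)]
        exact congrArg (fun T : H →L[ℂ] H => T x) (hP j).isIdempotentElem.eq
      · exact isSelfAdjoint_sum _ fun k _ => (hP k).isSelfAdjoint
      · simp [sum_apply, h]
    have hsum : ∀ x, HasSum (fun k => (ν x).real (A k)) ((ν x).real (⋃ k, A k)) := by
      intro x
      have := hfin x
      exact hasSum_real_iUnion hdisj hA
    refine exists_starProjection_of_tendsto (fun n => ∑ k ∈ Finset.range n, P k)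
      (fun n => (hS _).1.isSelfAdjoint) (fun x => ?_) _ (fun x => ?_) (fun x => ?_)
    · have hS' : ∀ (s : Finset ℕ) y, ‖(∑ k ∈ s, P k) y‖ ^ 2 = ∑ k ∈ s, (ν y).real (A k) := by
        intro s y
        have := (starProjection_inner_eq (hS s).1 y).symm.trans ((hS _).2 y)
        exact_mod_cast this
      have hle : ∀ m n : ℕ, m ≤ n →
          dist ((∑ k ∈ Finset.range m, P k) x) ((∑ k ∈ Finset.range n, P k) x) ^ 2
          = dist (∑ k ∈ Finset.range m, (ν x).real (A k))
              (∑ k ∈ Finset.range n, (ν x).real (A k)) := by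
        intro m n hmn
        rw [dist_comm, dist_comm (∑ k ∈ Finset.range m, (ν x).real (A k)), dist_eq_norm,
          ← sub_apply, ← Finset.sum_Ico_eq_sub _ hmn, hS', dist_eq_norm,
          ← Finset.sum_Ico_eq_sub _ hmn, Real.norm_of_nonneg]
        exact Finset.sum_nonneg fun k _ => measureReal_nonneg
      have key : ∀ p : ℕ × ℕ,
          dist ((∑ k ∈ Finset.range p.1, P k) x) ((∑ k ∈ Finset.range p.2, P k) x)
          = √(dist (∑ k ∈ Finset.range p.1, (ν x).real (A k))
              (∑ k ∈ Finset.range p.2, (ν x).real (A k))) := by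
        intro p
        rcases le_total p.1 p.2 with hp | hp
        · rw [← hle _ _ hp, Real.sqrt_sq dist_nonneg]
        · rw [dist_comm, dist_comm (∑ k ∈ Finset.range p.1, (ν x).real (A k)), ← hle _ _ hp,
            Real.sqrt_sq dist_nonneg]
      rw [cauchySeq_iff_tendsto_dist_atTop_0]
      simp only [key]
      rw [← Real.sqrt_zero]
      exact (Real.continuous_sqrt.tendsto _).comp
        (cauchySeq_iff_tendsto_dist_atTop_0.1 (hsum x).tendsto_sum_nat.cauchySeq)
    · simp only [(hS _).2]
      exact (Complex.continuous_ofReal.tendsto _).comp (hsum x).tendsto_sum_nat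
    · have : ∀ n, ‖(∑ k ∈ Finset.range n, P k) x‖ ^ 2
          = ∑ k ∈ Finset.range n, (ν x).real (A k) := by
        intro n
        have := (starProjection_inner_eq (hS (Finset.range n)).1 x).symm.trans ((hS _).2 x)
        exact_mod_cast this
      simp only [this]
      exact (hsum x).tendsto_sum_nat

namespace SpectralMeasure

/-- `⟨E(Ω)x, x⟩` is real and nonnegative, and equals `‖E(Ω)x‖²`. -/
theorem inner_proj (E : SpectralMeasure H) (x : H) {Ω : Set Circle} (hΩ : MeasurableSet Ω) :
    (⟪x, E.proj Ω x⟫_ℂ).re = ‖E.proj Ω x‖ ^ 2 := by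
  rw [starProjection_inner_eq (E.isStarProjection Ω hΩ) x, Complex.ofReal_re]

/-- The elementary measure `μ_x(Ω) = ⟨E(Ω)x, x⟩`, a finite positive Borel measure on the circle.
(Mathlib's inner product is linear in the second variable.) -/
noncomputable def elementaryMeasure (E : SpectralMeasure H) (x : H) : Measure Circle :=
  Measure.ofMeasurable (fun Ω _ => ENNReal.ofReal (⟪x, E.proj Ω x⟫_ℂ).re)
    (by simp [E.empty])
    (by
      intro Ω hΩ hdisj
      have h := Complex.hasSum_re
        ((E.hasSum_iUnion Ω hΩ hdisj x).mapL (innerSL ℂ x))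
      have h0 : ∀ n, 0 ≤ (⟪x, E.proj (Ω n) x⟫_ℂ).re := fun n => by
        rw [E.inner_proj x (hΩ n)]; positivity
      exact (congrArg ENNReal.ofReal h.tsum_eq.symm).trans
        (ENNReal.ofReal_tsum_of_nonneg h0 h.summable))

theorem elementaryMeasure_apply (E : SpectralMeasure H) (x : H) {Ω : Set Circle}
    (hΩ : MeasurableSet Ω) :
    E.elementaryMeasure x Ω = ENNReal.ofReal (⟪x, E.proj Ω x⟫_ℂ).re :=
  Measure.ofMeasurable_apply Ω hΩ

/-- `E` is the spectral measure of the unitary operator `U`, that is `U = ∫ ξ dE(ξ)` in the weak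
sense: `⟨Ux, x⟩ = ∫ ξ dμ_x(ξ)` for all `x`. By polarization this is the same as
`⟨Ux, y⟩ = ∫ ξ d⟨E(ξ)x, y⟩` for all `x` and `y`. -/
def IsSpectralMeasureOf (E : SpectralMeasure H) (U : unitary (H →L[ℂ] H)) : Prop :=
  ∀ x : H, ⟪x, (U : H →L[ℂ] H) x⟫_ℂ = ∫ ξ : Circle, (ξ : ℂ) ∂(E.elementaryMeasure x)

end SpectralMeasure

/-- The existence half of the spectral theorem for unitary operators. -/
theorem exists_isSpectralMeasureOf (U : unitary (H →L[ℂ] H)) :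
    ∃ E : SpectralMeasure H, E.IsSpectralMeasureOf U := by
  classical
  obtain ⟨φ, hφ⟩ := exists_circle_calculus U
  choose ν hfin hν using exists_circle_measure φ
  choose P hP hPν using exists_proj_of_measurable φ ν hfin hν
  have hre : ∀ Ω hΩ x, ‖P Ω hΩ x‖ ^ 2 = (ν x).real Ω := by
    intro Ω hΩ x
    have := (starProjection_inner_eq (hP Ω hΩ) x).symm.trans (hPν Ω hΩ x)
    exact_mod_cast this
  let E : SpectralMeasure H :=
    { proj := fun Ω => if h : MeasurableSet Ω then P Ω h else 0
      isStarProjection := fun Ω h => by simpa [h] using hP Ω h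
      not_measurable := fun Ω h => by simp [h]
      empty := by
        simp only [MeasurableSet.empty, dite_true]
        refine clm_ext_of_inner_self fun x => ?_
        rw [hPν]; simp
      univ := by
        simp only [MeasurableSet.univ, dite_true]
        refine clm_ext_of_inner_self fun x => ?_
        rw [hPν]
        have h := circle_calculus_inner φ x (hν x) 1
        have h1 : circleOfReal 1 = 1 := by ext ξ; simp [circleOfReal]
        rw [h1, map_one] at h
        simpa using h.symm
      hasSum_iUnion := by
        intro Ω hΩ hdisj x
        simp only [MeasurableSet.iUnion hΩ, hΩ, dite_true]
        have := hfin x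
        have hfin' := hfin
        have hdiff : ∀ s : Finset ℕ, P (⋃ n, Ω n) (.iUnion hΩ) - ∑ k ∈ s, P (Ω k) (hΩ k)
            = P ((⋃ n, Ω n) \ ⋃ k ∈ s, Ω k)
              ((MeasurableSet.iUnion hΩ).diff (s.measurableSet_biUnion fun k _ => hΩ k)) := by
          intro s
          refine clm_ext_of_inner_self fun y => ?_
          rw [hPν, measureReal_sdiff (Set.iUnion₂_subset fun k _ => Set.subset_iUnion Ω k)
            (s.measurableSet_biUnion fun k _ => hΩ k),
            measureReal_biUnion_finset (fun i _ j _ hij => hdisj hij) fun k _ => hΩ k,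
            sub_apply, inner_sub_right, hPν, sum_apply, inner_sum]
          simp [hPν]
        have hlim : Tendsto (fun s : Finset ℕ => ‖(∑ k ∈ s, P (Ω k) (hΩ k) x)
            - P (⋃ n, Ω n) (.iUnion hΩ) x‖ ^ 2) atTop (𝓝 0) := by
          have : ∀ s : Finset ℕ, ‖(∑ k ∈ s, P (Ω k) (hΩ k) x) - P (⋃ n, Ω n) (.iUnion hΩ) x‖ ^ 2
              = (ν x).real (⋃ n, Ω n) - ∑ k ∈ s, (ν x).real (Ω k) := by
            intro s
            rw [norm_sub_rev, ← sum_apply, ← sub_apply, hdiff s, hre,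
              measureReal_sdiff (Set.iUnion₂_subset fun k _ => Set.subset_iUnion Ω k)
              (s.measurableSet_biUnion fun k _ => hΩ k),
              measureReal_biUnion_finset (fun i _ j _ hij => hdisj hij) fun k _ => hΩ k]
          simp only [this]
          have h := (tendsto_const_nhds (x := (ν x).real (⋃ n, Ω n))).sub
            (hasSum_real_iUnion (ν := ν x) hdisj hΩ)
          rwa [sub_self] at h
        have h := (Real.continuous_sqrt.tendsto _).comp hlim
        rw [Real.sqrt_zero] at h
        refine tendsto_iff_norm_sub_tendsto_zero.2 (h.congr fun s => ?_)
        simp [Real.sqrt_sq] }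
  refine ⟨E, fun x => ?_⟩
  have := hfin x
  have hE : E.elementaryMeasure x = ν x := by
    ext Ω hΩ
    rw [E.elementaryMeasure_apply x hΩ]
    have : E.proj Ω = P Ω hΩ := by simp [E, hΩ]
    rw [this, hPν, Complex.ofReal_re, ofReal_measureReal]
  let a : C(Circle, ℝ) := ⟨fun ξ => (ξ : ℂ).re, by fun_prop⟩
  let b : C(Circle, ℝ) := ⟨fun ξ => (ξ : ℂ).im, by fun_prop⟩
  have hab : (⟨fun ξ => (ξ : ℂ), by fun_prop⟩ : C(Circle, ℂ))
      = circleOfReal a + Complex.I • circleOfReal b := by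
    ext ξ
    simp only [ContinuousMap.coe_mk, ContinuousMap.add_apply, ContinuousMap.smul_apply,
      circleOfReal, a, b, smul_eq_mul]
    rw [mul_comm]; exact (Complex.re_add_im _).symm
  have hia : Integrable (fun ξ => a ξ) (ν x) :=
    a.continuous.integrable_of_hasCompactSupport (HasCompactSupport.of_compactSpace _)
  have hib : Integrable (fun ξ => b ξ) (ν x) :=
    b.continuous.integrable_of_hasCompactSupport (HasCompactSupport.of_compactSpace _)
  rw [hE, ← hφ, hab, map_add, map_smul, add_apply, smul_apply, inner_add_right, inner_smul_right,
    circle_calculus_inner φ x (hν x), circle_calculus_inner φ x (hν x),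
    ← integral_complex_ofReal, ← integral_complex_ofReal, ← integral_const_mul,
    ← integral_add hia.ofReal (hib.ofReal.const_mul _)]
  refine integral_congr_ae (ae_of_all _ fun ξ => ?_)
  change (((ξ : ℂ).re : ℂ) + Complex.I * ((ξ : ℂ).im : ℂ)) = ξ
  rw [mul_comm]; exact Complex.re_add_im _

/-- The spectral measure of a unitary operator `U`: the (unique) spectral measure `E` on the
circle with `U = ∫ ξ dE(ξ)`. -/
noncomputable def spectralMeasure (U : unitary (H →L[ℂ] H)) : SpectralMeasure H :=
  (exists_isSpectralMeasureOf U).choose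

theorem spectralMeasure_spec (U : unitary (H →L[ℂ] H)) :
    (spectralMeasure U).IsSpectralMeasureOf U :=
  (exists_isSpectralMeasureOf U).choose_spec

theorem SpectralMeasure.elementaryMeasure_absolutelyContinuous_iff (E : SpectralMeasure H) (x : H)
    (μ : Measure Circle) : E.elementaryMeasure x ≪ μ ↔
      ∀ Ω, MeasurableSet Ω → μ Ω = 0 → E.proj Ω x = 0 := by
  have key : ∀ Ω, MeasurableSet Ω → (E.elementaryMeasure x Ω = 0 ↔ E.proj Ω x = 0) := by
    intro Ω hΩ
    rw [E.elementaryMeasure_apply x hΩ, E.inner_proj x hΩ, ENNReal.ofReal_eq_zero]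
    constructor
    · intro h
      exact norm_eq_zero.1 (pow_eq_zero_iff two_ne_zero |>.1 (le_antisymm h (sq_nonneg _)))
    · intro h; simp [h]
  constructor
  · intro h Ω hΩ h0
    exact (key Ω hΩ).1 (h h0)
  · intro h
    exact Measure.AbsolutelyContinuous.mk fun Ω hΩ h0 => (key Ω hΩ).2 (h Ω hΩ h0)

/-- The subspace `H_μ = {x : μ_x ≪ μ}`, where `μ_x` are the elementary measures of the spectral
measure of `U`. -/
noncomputable def spectralSubspace (U : unitary (H →L[ℂ] H)) (μ : Measure Circle) :
    Submodule ℂ H where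
  carrier := {x | (spectralMeasure U).elementaryMeasure x ≪ μ}
  zero_mem' := by
    rw [Set.mem_ofPred_eq, SpectralMeasure.elementaryMeasure_absolutelyContinuous_iff]
    intro Ω _ _; simp
  add_mem' := by
    intro x y hx hy
    rw [Set.mem_ofPred_eq, SpectralMeasure.elementaryMeasure_absolutelyContinuous_iff] at *
    intro Ω hΩ h0; rw [map_add, hx Ω hΩ h0, hy Ω hΩ h0, add_zero]
  smul_mem' := by
    intro c x hx
    rw [Set.mem_ofPred_eq, SpectralMeasure.elementaryMeasure_absolutelyContinuous_iff] at *
    intro Ω hΩ h0; rw [map_smul, hx Ω hΩ h0, smul_zero]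

/-- The set of commuting conjugations of `U`: the bounded antilinear `C : H → H` that are isometric
and involutive (conjugations) and satisfy `C U C = U`. -/
def commutingConjugations (U : unitary (H →L[ℂ] H)) : Set (H →L⋆[ℂ] H) :=
  {C | (∀ x, ‖C x‖ = ‖x‖) ∧ (∀ x, C (C x) = x) ∧ ∀ x, C ((U : H →L[ℂ] H) (C x)) = (U : H →L[ℂ] H) x}

end

/-- The complex conjugate `ξ ↦ conj ξ` as a map from the circle to itself. -/
noncomputable def circleConj (ξ : Circle) : Circle :=
  ⟨starRingEnd ℂ (ξ : ℂ), by
    have h : ‖(ξ : ℂ)‖ = 1 := Circle.norm_coe ξ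
    simp [Submonoid.unitSphere, h]⟩

theorem measurable_circleConj : Measurable circleConj := by
  have h : circleConj = fun ξ : Circle => ξ⁻¹ :=
    funext fun ξ => Circle.ext (Circle.coe_inv_eq_conj ξ).symm
  have hc : Continuous circleConj := h ▸ continuous_inv
  exact hc.measurable

/-- The measure `μ^c(Ω) = μ(Ω*)`, where `Ω* = {conj ξ : ξ ∈ Ω}`: the image of `μ` under complex
conjugation. -/
noncomputable def conjMeasure (μ : Measure Circle) : Measure Circle := μ.map circleConj

theorem conjMeasure_apply (μ : Measure Circle) {Ω : Set Circle} (hΩ : MeasurableSet Ω) :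
    conjMeasure μ Ω = μ (circleConj '' Ω) := by
  have hinv : Function.Involutive circleConj := fun ξ => Circle.ext (by simp [circleConj])
  rw [conjMeasure, Measure.map_apply measurable_circleConj hΩ,
    Set.image_eq_preimage_of_inverse hinv hinv]

/-! The theorem rests on one identity, μ_{Cx} = (μ_x)^c, proved in
`elementaryMeasure_commutingConjugation`. Since C² = I, the relation CUC = U says that C commutes
with U, hence with every power of U. An antilinear isometry conjugates inner products, so ⟨UᵐCx, Cx⟩
is the complex conjugate of ⟨Uᵐx, x⟩. In terms of moments, ∫ ξᵐ dμ_{Cx} is the conjugate of ∫ ξᵐ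
dμ_x, which is the m-th moment of the reflected measure. Finite measures on the circle with the same
moments coincide (`circle_measure_ext`).

Reflection preserves absolute continuity, so C maps H_μ into H_{μ^c}. Reflection is an involution,
so C also maps H_{μ^c} back into H_μ, and C² = I turns the two inclusions into equalities. The
orthogonal complements follow because C preserves orthogonality.

The analytic work lies in the moments. The defining property of E is only the quadratic identity
⟨Ux, x⟩ = ∫ ξ dμ_x. It is upgraded to all powers in `IsSpectralMeasureOf.inner_map_pow`: E(Ω)
commutes with U, and on the range of E(Ω), for Ω within ε of a point c, U is within ε of the scalar
c. Cutting the circle into small pieces then gives the formula. -/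

namespace SpectralMeasure

variable {H : Type*} [NormedAddCommGroup H] [InnerProductSpace ℂ H] [CompleteSpace H]

/-! ### Algebra of a spectral measure -/

theorem elementaryMeasure_apply_eq_norm_sq (E : SpectralMeasure H) (x : H) {Ω : Set Circle}
    (hΩ : MeasurableSet Ω) : E.elementaryMeasure x Ω = ENNReal.ofReal (‖E.proj Ω x‖ ^ 2) := by
  rw [E.elementaryMeasure_apply x hΩ, E.inner_proj x hΩ]

instance (E : SpectralMeasure H) (x : H) : IsFiniteMeasure (E.elementaryMeasure x) :=
  ⟨by rw [E.elementaryMeasure_apply x .univ]; exact ENNReal.ofReal_lt_top⟩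

theorem elementaryMeasure_real (E : SpectralMeasure H) (x : H) {Ω : Set Circle}
    (hΩ : MeasurableSet Ω) : (E.elementaryMeasure x).real Ω = ‖E.proj Ω x‖ ^ 2 := by
  rw [measureReal_def, E.elementaryMeasure_apply_eq_norm_sq x hΩ,
    ENNReal.toReal_ofReal (sq_nonneg _)]

theorem elementaryMeasure_real_univ (E : SpectralMeasure H) (x : H) :
    (E.elementaryMeasure x).real Set.univ = ‖x‖ ^ 2 := by
  rw [E.elementaryMeasure_real x .univ, E.univ, one_apply_eq_self]

theorem proj_proj_self (E : SpectralMeasure H) (x : H) {Ω : Set Circle}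
    (hΩ : MeasurableSet Ω) : E.proj Ω (E.proj Ω x) = E.proj Ω x :=
  congrArg (fun T : H →L[ℂ] H => T x) (E.isStarProjection Ω hΩ).isIdempotentElem.eq

theorem inner_proj_left (E : SpectralMeasure H) (x y : H) {Ω : Set Circle}
    (hΩ : MeasurableSet Ω) : ⟪E.proj Ω x, y⟫_ℂ = ⟪x, E.proj Ω y⟫_ℂ :=
  ContinuousLinearMap.isSelfAdjoint_iff_isSymmetric.1
    (E.isStarProjection Ω hΩ).isSelfAdjoint x y

theorem proj_union (E : SpectralMeasure H) {A B : Set Circle} (hA : MeasurableSet A)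
    (hB : MeasurableSet B) (h : Disjoint A B) : E.proj (A ∪ B) = E.proj A + E.proj B := by
  refine clm_ext_of_inner_self fun x => ?_
  rw [starProjection_inner_eq (E.isStarProjection _ (hA.union hB)), add_apply, inner_add_right,
    starProjection_inner_eq (E.isStarProjection _ hA),
    starProjection_inner_eq (E.isStarProjection _ hB), ← E.elementaryMeasure_real x hA,
    ← E.elementaryMeasure_real x hB, ← E.elementaryMeasure_real x (hA.union hB),
    measureReal_union h hB, Complex.ofReal_add]

theorem proj_compl (E : SpectralMeasure H) {A : Set Circle} (hA : MeasurableSet A) :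
    E.proj Aᶜ = 1 - E.proj A := by
  rw [eq_sub_iff_add_eq', ← E.proj_union hA hA.compl disjoint_compl_right, Set.union_compl_self,
    E.univ]

/-- The measure of E(A)x has total mass ‖E(A)x‖², and A already carries all of it, so nothing is
left for B. -/
theorem proj_proj_of_disjoint (E : SpectralMeasure H) {A B : Set Circle} (hA : MeasurableSet A)
    (hB : MeasurableSet B) (h : Disjoint A B) (x : H) : E.proj B (E.proj A x) = 0 := by
  have h1 := E.elementaryMeasure_real (E.proj A x) (hA.union hB)
  rw [measureReal_union h hB, E.elementaryMeasure_real _ hA, E.elementaryMeasure_real _ hB,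
    E.proj_proj_self x hA, ← E.elementaryMeasure_real _ (hA.union hB)] at h1
  have h2 : (E.elementaryMeasure (E.proj A x)).real (A ∪ B) ≤ _ :=
    measureReal_mono (Set.subset_univ _)
  rw [E.elementaryMeasure_real_univ] at h2
  have : ‖E.proj B (E.proj A x)‖ ^ 2 ≤ 0 := by linarith
  exact norm_eq_zero.1 (pow_eq_zero_iff two_ne_zero |>.1 (le_antisymm this (sq_nonneg _)))

/-- Splitting each set along A ∩ B leaves cross terms between disjoint sets only, and these vanish.
-/
theorem proj_proj (E : SpectralMeasure H) {A B : Set Circle} (hA : MeasurableSet A)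
    (hB : MeasurableSet B) (x : H) : E.proj A (E.proj B x) = E.proj (A ∩ B) x := by
  have e1 : E.proj A = E.proj (A ∩ B) + E.proj (A \ B) := by
    rw [← E.proj_union (hA.inter hB) (hA.diff hB) Set.disjoint_sdiff_inter.symm,
      Set.inter_union_sdiff]
  have e2 : E.proj B = E.proj (A ∩ B) + E.proj (B \ A) := by
    rw [Set.inter_comm, ← E.proj_union (hB.inter hA) (hB.diff hA) Set.disjoint_sdiff_inter.symm,
      Set.inter_union_sdiff]
  have e3 : E.proj (A \ B) (E.proj B x) = 0 :=
    E.proj_proj_of_disjoint hB (hA.diff hB) Set.disjoint_sdiff_right x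
  have e4 : E.proj (A ∩ B) (E.proj (B \ A) x) = 0 :=
    E.proj_proj_of_disjoint (hB.diff hA) (hA.inter hB)
      (Set.disjoint_sdiff_left.mono_right Set.inter_subset_left) x
  rw [e1, add_apply, e3, e2, add_apply, map_add, e4, E.proj_proj_self x (hA.inter hB), add_zero,
    add_zero]

theorem elementaryMeasure_proj (E : SpectralMeasure H) {Ω : Set Circle} (hΩ : MeasurableSet Ω)
    (x : H) : E.elementaryMeasure (E.proj Ω x) = (E.elementaryMeasure x).restrict Ω := by
  ext A hA
  rw [Measure.restrict_apply hA, E.elementaryMeasure_apply_eq_norm_sq _ hA,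
    E.elementaryMeasure_apply_eq_norm_sq _ (hA.inter hΩ), E.proj_proj hA hΩ]

/-- By Pythagoras, as the two components stay orthogonal under every E(A). This lets the quadratic
relation between E and U see off-diagonal terms. -/
theorem elementaryMeasure_add_proj_compl (E : SpectralMeasure H) {Ω : Set Circle}
    (hΩ : MeasurableSet Ω) (y z : H) :
    E.elementaryMeasure (E.proj Ω y + E.proj Ωᶜ z)
      = E.elementaryMeasure (E.proj Ω y) + E.elementaryMeasure (E.proj Ωᶜ z) := by
  ext A hA
  have h : ⟪E.proj (A ∩ Ω) y, E.proj (A ∩ Ωᶜ) z⟫_ℂ = 0 := by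
    rw [E.inner_proj_left _ _ (hA.inter hΩ), E.proj_proj_of_disjoint (hA.inter hΩ.compl)
      (hA.inter hΩ) (disjoint_compl_left.mono Set.inter_subset_right Set.inter_subset_right),
      inner_zero_right]
  rw [Measure.add_apply, E.elementaryMeasure_apply_eq_norm_sq _ hA,
    E.elementaryMeasure_apply_eq_norm_sq _ hA, E.elementaryMeasure_apply_eq_norm_sq _ hA, map_add,
    E.proj_proj hA hΩ, E.proj_proj hA hΩ.compl,
    ← ENNReal.ofReal_add (sq_nonneg _) (sq_nonneg _)]
  simpa only [sq] using
    congrArg ENNReal.ofReal (norm_add_sq_eq_norm_sq_add_norm_sq_of_inner_eq_zero _ _ h)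

/-! ### Commutation with U and the moment formula -/

theorem integrable_pow (μ : Measure Circle) [IsFiniteMeasure μ] (m : ℕ) :
    Integrable (fun ξ : Circle => (ξ : ℂ) ^ m) μ :=
  Continuous.integrable_of_hasCompactSupport (by fun_prop) (HasCompactSupport.of_compactSpace _)

variable {E : SpectralMeasure H} {U : unitary (H →L[ℂ] H)}

theorem IsSpectralMeasureOf.inner_map_proj_compl (hE : E.IsSpectralMeasureOf U) {Ω : Set Circle}
    (hΩ : MeasurableSet Ω) (y z : H) :
    ⟪E.proj Ω y, (U : H →L[ℂ] H) (E.proj Ωᶜ z)⟫_ℂ = 0 := by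
  have key : ∀ w, ⟪E.proj Ω y, (U : H →L[ℂ] H) (E.proj Ωᶜ w)⟫_ℂ
      + ⟪E.proj Ωᶜ w, (U : H →L[ℂ] H) (E.proj Ω y)⟫_ℂ = 0 := by
    intro w
    have h := hE (E.proj Ω y + E.proj Ωᶜ w)
    rw [E.elementaryMeasure_add_proj_compl hΩ, integral_add_measure
      (by simpa using integrable_pow _ 1) (by simpa using integrable_pow _ 1), ← hE, ← hE,
      map_add, inner_add_left, inner_add_right, inner_add_right] at h
    linear_combination h
  have h1 := key z
  -- The two terms of `key` are linear and antilinear in w, so replacing z by iz changes their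
  -- relative sign and isolates the first.
  have h2 := key (Complex.I • z)
  rw [map_smul, map_smul, inner_smul_right, inner_smul_left, Complex.conj_I] at h2
  have h3 : (2 * Complex.I) * ⟪E.proj Ω y, (U : H →L[ℂ] H) (E.proj Ωᶜ z)⟫_ℂ = 0 := by
    linear_combination h2 + Complex.I * h1
  simpa using h3

/-- Both off-diagonal blocks of U, from Ωᶜ to Ω and from Ω to Ωᶜ, vanish, so U is block diagonal. -/
theorem IsSpectralMeasureOf.proj_map (hE : E.IsSpectralMeasureOf U) {Ω : Set Circle}
    (hΩ : MeasurableSet Ω) (x : H) :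
    E.proj Ω ((U : H →L[ℂ] H) x) = (U : H →L[ℂ] H) (E.proj Ω x) := by
  have h : ∀ {A : Set Circle}, MeasurableSet A → ∀ z,
      E.proj A ((U : H →L[ℂ] H) (E.proj Aᶜ z)) = 0 := by
    intro A hA z
    refine ext_inner_left ℂ fun y => ?_
    rw [← E.inner_proj_left _ _ hA, hE.inner_map_proj_compl hA, inner_zero_right]
  have h1 := h hΩ x
  have h2 := h hΩ.compl x
  rw [E.proj_compl hΩ, sub_apply, one_apply_eq_self, map_sub, map_sub, sub_eq_zero] at h1
  rw [compl_compl, E.proj_compl hΩ, sub_apply, one_apply_eq_self, sub_eq_zero] at h2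
  rw [h1, h2, E.proj_proj_self _ hΩ]

theorem IsSpectralMeasureOf.proj_map_pow (hE : E.IsSpectralMeasureOf U) {Ω : Set Circle}
    (hΩ : MeasurableSet Ω) (m : ℕ) (x : H) :
    E.proj Ω (((U : H →L[ℂ] H) ^ m) x) = ((U : H →L[ℂ] H) ^ m) (E.proj Ω x) := by
  have h : Commute (E.proj Ω) (U : H →L[ℂ] H) := ContinuousLinearMap.ext fun x => hE.proj_map hΩ x
  exact congrArg (fun T : H →L[ℂ] H => T x) (h.pow_right m).eq

theorem norm_unitary_apply (U : unitary (H →L[ℂ] H)) (x : H) : ‖(U : H →L[ℂ] H) x‖ = ‖x‖ :=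
  (Unitary.linearIsometryEquiv U).norm_map x

theorem norm_pow_apply_sub_le (U : unitary (H →L[ℂ] H)) (c : Circle) (m : ℕ) (x : H) :
    ‖((U : H →L[ℂ] H) ^ m) x - (c : ℂ) ^ m • x‖ ≤ m * ‖(U : H →L[ℂ] H) x - (c : ℂ) • x‖ := by
  induction m with
  | zero => simp
  | succ m ih =>
    have h : ((U : H →L[ℂ] H) ^ (m + 1)) x - (c : ℂ) ^ (m + 1) • x
        = (U : H →L[ℂ] H) (((U : H →L[ℂ] H) ^ m) x - (c : ℂ) ^ m • x)
          + (c : ℂ) ^ m • ((U : H →L[ℂ] H) x - (c : ℂ) • x) := by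
      rw [pow_succ', mul_apply_eq_comp, map_sub, map_smul, smul_sub, smul_smul, pow_succ]
      abel
    rw [h]
    refine (norm_add_le _ _).trans ?_
    rw [norm_unitary_apply, norm_smul, norm_pow, Circle.norm_coe, one_pow, one_mul]
    rw [Nat.cast_succ]
    linarith

theorem norm_pow_sub_pow_le (ξ c : Circle) (m : ℕ) :
    ‖(ξ : ℂ) ^ m - (c : ℂ) ^ m‖ ≤ m * ‖(ξ : ℂ) - c‖ := by
  induction m with
  | zero => simp
  | succ m ih =>
    have h : (ξ : ℂ) ^ (m + 1) - (c : ℂ) ^ (m + 1)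
        = ξ * ((ξ : ℂ) ^ m - (c : ℂ) ^ m) + (c : ℂ) ^ m * (ξ - c) := by ring
    rw [h]
    refine (norm_add_le _ _).trans ?_
    rw [norm_mul, norm_mul, norm_pow, Circle.norm_coe, Circle.norm_coe, one_pow, one_mul, one_mul]
    push_cast
    linarith

theorem norm_integral_pow_sub_le {ν : Measure Circle} [IsFiniteMeasure ν] {c : Circle} {ε : ℝ}
    (h : ∀ᵐ ξ ∂ν, dist ξ c ≤ ε) (m : ℕ) :
    ‖∫ ξ, (ξ : ℂ) ^ m ∂ν - (c : ℂ) ^ m * (ν.real Set.univ : ℂ)‖ ≤ m * ε * ν.real Set.univ := by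
  have e : ∫ ξ, (ξ : ℂ) ^ m ∂ν - (c : ℂ) ^ m * (ν.real Set.univ : ℂ)
      = ∫ ξ, ((ξ : ℂ) ^ m - (c : ℂ) ^ m) ∂ν := by
    rw [integral_sub (integrable_pow ν m) (integrable_const _), integral_const,
      Complex.real_smul, mul_comm]
  rw [e]
  refine norm_integral_le_of_norm_le_const (h.mono fun ξ hξ => ?_)
  refine (norm_pow_sub_pow_le ξ c m).trans ?_
  rw [← dist_eq_norm]
  exact mul_le_mul_of_nonneg_left hξ m.cast_nonneg

/-- On the unit circle |ξ − c|² = 2 − 2 Re(c̄ξ), which is affine in ξ. The first moment, all that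
the definition of E supplies, is therefore enough. -/
theorem IsSpectralMeasureOf.norm_map_sub_sq (hE : E.IsSpectralMeasureOf U) (c : Circle) (x : H) :
    ‖(U : H →L[ℂ] H) x - (c : ℂ) • x‖ ^ 2
      = ∫ ξ : Circle, ‖(ξ : ℂ) - c‖ ^ 2 ∂(E.elementaryMeasure x) := by
  have e : ∀ ξ : Circle, ‖(ξ : ℂ) - c‖ ^ 2 = 2 - 2 * (starRingEnd ℂ (c : ℂ) * ξ).re := by
    intro ξ
    have h := norm_sub_sq (𝕜 := ℂ) (c : ℂ) (ξ : ℂ)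
    rw [norm_sub_rev, Circle.norm_coe, Circle.norm_coe, RCLike.inner_apply, mul_comm (ξ : ℂ)] at h
    change _ = _ - 2 * (starRingEnd ℂ (c : ℂ) * ξ).re + _ at h
    linarith
  have hi : Integrable (fun ξ : Circle => starRingEnd ℂ (c : ℂ) * (ξ : ℂ))
      (E.elementaryMeasure x) := by
    simpa using (integrable_pow (E.elementaryMeasure x) 1).const_mul (starRingEnd ℂ (c : ℂ))
  have h2 : ∫ ξ : Circle, (starRingEnd ℂ (c : ℂ) * ξ).re ∂(E.elementaryMeasure x)
      = (starRingEnd ℂ (c : ℂ) * ⟪x, (U : H →L[ℂ] H) x⟫_ℂ).re := by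
    rw [hE x, ← integral_const_mul]
    exact integral_re hi
  have hr : Integrable (fun ξ : Circle => 2 * (starRingEnd ℂ (c : ℂ) * ξ).re)
      (E.elementaryMeasure x) := hi.re.const_mul 2
  rw [integral_congr_ae (ae_of_all _ e), integral_sub (integrable_const _) hr,
    integral_const_mul, h2,
    integral_const, E.elementaryMeasure_real_univ, smul_eq_mul, norm_sub_rev,
    norm_sub_sq (𝕜 := ℂ), inner_smul_left, norm_smul, Circle.norm_coe, norm_unitary_apply]
  change _ - 2 * (starRingEnd ℂ (c : ℂ) * ⟪x, (U : H →L[ℂ] H) x⟫_ℂ).re + _ = _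
  ring

theorem IsSpectralMeasureOf.norm_map_sub_le (hE : E.IsSpectralMeasureOf U) {c : Circle} {ε : ℝ}
    (hε : 0 ≤ ε) {x : H} (h : ∀ᵐ ξ ∂(E.elementaryMeasure x), dist ξ c ≤ ε) :
    ‖(U : H →L[ℂ] H) x - (c : ℂ) • x‖ ≤ ε * ‖x‖ := by
  refine le_of_sq_le_sq ?_ (by positivity)
  rw [hE.norm_map_sub_sq, mul_pow, ← E.elementaryMeasure_real_univ x]
  refine (Real.le_norm_self _).trans (norm_integral_le_of_norm_le_const (h.mono fun ξ hξ => ?_))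
  rw [Real.norm_of_nonneg (sq_nonneg _), ← dist_eq_norm]
  exact pow_le_pow_left₀ dist_nonneg hξ 2

/-- Both quantities lie within mε‖x‖² of cᵐ‖x‖², hence the factor 2. The bound is proportional to
‖x‖², so it can be summed over orthogonal pieces. -/
theorem IsSpectralMeasureOf.norm_inner_map_pow_sub_integral_le (hE : E.IsSpectralMeasureOf U)
    {c : Circle} {ε : ℝ} (hε : 0 ≤ ε) {x : H}
    (h : ∀ᵐ ξ ∂(E.elementaryMeasure x), dist ξ c ≤ ε) (m : ℕ) :
    ‖⟪x, ((U : H →L[ℂ] H) ^ m) x⟫_ℂ - ∫ ξ, (ξ : ℂ) ^ m ∂(E.elementaryMeasure x)‖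
      ≤ 2 * m * ε * ‖x‖ ^ 2 := by
  have h1 := norm_integral_pow_sub_le h m
  rw [E.elementaryMeasure_real_univ] at h1
  have h2 : ‖⟪x, ((U : H →L[ℂ] H) ^ m) x⟫_ℂ - (c : ℂ) ^ m * ((‖x‖ ^ 2 : ℝ) : ℂ)‖
      ≤ m * ε * ‖x‖ ^ 2 := by
    have e : ⟪x, ((U : H →L[ℂ] H) ^ m) x⟫_ℂ - (c : ℂ) ^ m * ((‖x‖ ^ 2 : ℝ) : ℂ)
        = ⟪x, ((U : H →L[ℂ] H) ^ m) x - (c : ℂ) ^ m • x⟫_ℂ := by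
      rw [inner_sub_right, inner_smul_right, inner_self_eq_norm_sq_to_K]
      simp
    rw [e]
    calc _ ≤ ‖x‖ * (m * (ε * ‖x‖)) := (norm_inner_le_norm _ _).trans <| by
          gcongr
          exact (norm_pow_apply_sub_le U c m x).trans
            (by gcongr; exact hE.norm_map_sub_le hε h)
      _ = _ := by ring
  calc _ ≤ _ := norm_sub_le_norm_sub_add_norm_sub _ ((c : ℂ) ^ m * ((‖x‖ ^ 2 : ℝ) : ℂ)) _
    _ ≤ _ := by
      rw [norm_sub_rev ((c : ℂ) ^ m * ((‖x‖ ^ 2 : ℝ) : ℂ))]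
      linarith

/-- The moments of the elementary measures: `⟨Uᵐx, x⟩ = ∫ ξᵐ dμ_x(ξ)`. -/
theorem IsSpectralMeasureOf.inner_map_pow (hE : E.IsSpectralMeasureOf U) (m : ℕ) (x : H) :
    ⟪x, ((U : H →L[ℂ] H) ^ m) x⟫_ℂ = ∫ ξ, (ξ : ℂ) ^ m ∂(E.elementaryMeasure x) := by
  have bound : ∀ ε : ℝ, 0 < ε →
      ‖⟪x, ((U : H →L[ℂ] H) ^ m) x⟫_ℂ - ∫ ξ, (ξ : ℂ) ^ m ∂(E.elementaryMeasure x)‖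
        ≤ 2 * m * ε * ‖x‖ ^ 2 := by
    intro ε hε
    let c : ℕ → Circle := TopologicalSpace.denseSeq Circle
    -- A countable Borel partition of the circle whose n-th piece lies within ε of c n.
    let B : ℕ → Set Circle := disjointed fun n => Metric.ball (c n) ε
    have hB : ∀ n, MeasurableSet (B n) := MeasurableSet.disjointed fun n => measurableSet_ball
    have hd : Pairwise (Function.onFun Disjoint B) := disjoint_disjointed _
    have hU : ⋃ n, B n = Set.univ := by
      rw [iUnion_disjointed, Set.eq_univ_iff_forall]
      intro ξ
      obtain ⟨n, hn⟩ := (TopologicalSpace.denseRange_denseSeq Circle).exists_dist_lt ξ hε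
      exact Set.mem_iUnion.2 ⟨n, hn⟩
    -- No cross terms appear because each E(B n) commutes with Uᵐ.
    have s1 : HasSum (fun n => ⟪E.proj (B n) x, ((U : H →L[ℂ] H) ^ m) (E.proj (B n) x)⟫_ℂ)
        ⟪x, ((U : H →L[ℂ] H) ^ m) x⟫_ℂ := by
      have h := E.hasSum_iUnion B hB hd x
      rw [hU, E.univ, one_apply_eq_self] at h
      have h' := (h.mapL ((U : H →L[ℂ] H) ^ m)).mapL (innerSL ℂ x)
      refine h'.congr_fun fun n => ?_
      rw [E.inner_proj_left _ _ (hB n), ← hE.proj_map_pow (hB n), E.proj_proj_self _ (hB n)]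
      simp
    have s2 : HasSum (fun n => ∫ ξ, (ξ : ℂ) ^ m ∂(E.elementaryMeasure (E.proj (B n) x)))
        (∫ ξ, (ξ : ℂ) ^ m ∂(E.elementaryMeasure x)) := by
      have h := hasSum_integral_iUnion hB hd
        (integrable_pow (E.elementaryMeasure x) m).integrableOn
      rw [hU, Measure.restrict_univ] at h
      simpa only [E.elementaryMeasure_proj (hB _)] using h
    -- The errors on infinitely many pieces stay of order ε, since the squared norms of the
    -- components of x add up to ‖x‖².
    have s3 : HasSum (fun n => 2 * m * ε * ‖E.proj (B n) x‖ ^ 2) (2 * m * ε * ‖x‖ ^ 2) := by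
      have h := hasSum_real_iUnion (ν := E.elementaryMeasure x) hd hB
      rw [hU, E.elementaryMeasure_real_univ] at h
      simpa only [E.elementaryMeasure_real _ (hB _)] using h.mul_left (2 * m * ε)
    rw [← (s1.sub s2).tsum_eq]
    refine tsum_of_norm_bounded s3 fun n => ?_
    refine hE.norm_inner_map_pow_sub_integral_le hε.le (c := c n) ?_ m
    rw [E.elementaryMeasure_proj (hB n)]
    refine (ae_restrict_mem (hB n)).mono fun ξ hξ => ?_
    exact (Metric.mem_ball.1 (disjointed_subset _ n hξ)).le
  have hlim : Tendsto (fun ε : ℝ => 2 * m * ε * ‖x‖ ^ 2) (𝓝[>] 0) (𝓝 0) := by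
    have : Continuous fun ε : ℝ => 2 * m * ε * ‖x‖ ^ 2 := by fun_prop
    simpa using (this.tendsto 0).mono_left nhdsWithin_le_nhds
  have h0 := ge_of_tendsto hlim (eventually_mem_nhdsWithin.mono bound)
  exact sub_eq_zero.1 (norm_le_zero_iff.1 h0)

end SpectralMeasure

/-! ### Moments determine a measure on the circle -/

open BoundedContinuousFunction in
/-- A finite measure on the circle is determined by its Fourier coefficients. -/
theorem circle_measure_ext {ν ν' : Measure Circle} [IsFiniteMeasure ν] [IsFiniteMeasure ν']
    (h : ∀ m : ℕ, ∫ ξ, (ξ : ℂ) ^ m ∂ν = ∫ ξ, (ξ : ℂ) ^ m ∂ν') : ν = ν' := by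
  let e : ℤ → (Circle →ᵇ ℂ) := fun n => mkOfCompact
    ⟨fun ξ => ((ξ ^ n : Circle) : ℂ), continuous_subtype_val.comp (continuous_zpow n)⟩
  let A : StarSubalgebra ℂ (Circle →ᵇ ℂ) :=
    { toSubalgebra := Algebra.adjoin ℂ (Set.range e)
      star_mem' := by
        change Algebra.adjoin ℂ (Set.range e) ≤ star (Algebra.adjoin ℂ (Set.range e))
        refine Algebra.adjoin_le ?_
        rintro - ⟨n, rfl⟩
        refine Algebra.subset_adjoin ⟨-n, ?_⟩
        ext ξ
        simp [e, ← Circle.coe_inv_eq_conj] }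
  -- The characters ξⁿ are closed under products, so the algebra they generate is their linear span
  -- and integrals need comparing only on characters.
  have hspan : ∀ g ∈ A, g ∈ Submodule.span ℂ (Set.range e) := by
    intro g hg
    have : Subalgebra.toSubmodule (Algebra.adjoin ℂ (Set.range e))
        = Submodule.span ℂ (Set.range e) := by
      refine Algebra.adjoin_eq_span_of_subset _ (Set.Subset.trans ?_ Submodule.subset_span)
      intro f hf
      refine Submonoid.closure_induction (fun _ => id) ⟨0, ?_⟩ ?_ hf
      · ext ξ; simp [e]
      · rintro - - - - ⟨m, rfl⟩ ⟨n, rfl⟩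
        refine ⟨m + n, ?_⟩
        ext ξ; simp [e, zpow_add₀]
    rw [← this]; exact hg
  refine ext_of_forall_mem_subalgebra_integral_eq_of_pseudoEMetric_complete_countable
    (A := A) ?_ fun g hg => ?_
  · intro ξ η hne
    refine ⟨fun ζ => (ζ : ℂ), ⟨toContinuousMapStarₐ ℂ (e 1),
      ⟨e 1, Algebra.subset_adjoin ⟨1, rfl⟩, rfl⟩, ?_⟩, fun h => hne (Circle.ext h)⟩
    ext ζ; simp [e]
  · have hg' := hspan g hg
    clear hg
    induction hg' using Submodule.span_induction with
    | mem f hf =>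
      obtain ⟨n, rfl⟩ := hf
      obtain ⟨m, rfl | rfl⟩ := n.eq_nat_or_neg
      · simpa [e] using h m
      -- For a positive measure the negative moments are the conjugates of the positive ones, so
      -- exponents in ℕ suffice.
      · have hc : ∀ ρ : Measure Circle, ∫ ξ, e (-m) ξ ∂ρ
            = starRingEnd ℂ (∫ ξ, (ξ : ℂ) ^ m ∂ρ) := by
          intro ρ
          rw [← integral_conj]
          simp [e, ← Circle.coe_inv_eq_conj]
        rw [hc, hc, h]
    | zero => simp
    | add f g _ _ hf hg =>
      simp only [BoundedContinuousFunction.add_apply]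
      rw [integral_add (f.integrable _) (g.integrable _), integral_add (f.integrable _)
        (g.integrable _), hf, hg]
    | smul c f _ hf =>
      simp only [BoundedContinuousFunction.smul_apply]
      rw [integral_smul, integral_smul, hf]

theorem circleConj_involutive : Function.Involutive circleConj :=
  fun ξ => Circle.ext (by simp [circleConj])

theorem conjMeasure_conjMeasure (μ : Measure Circle) : conjMeasure (conjMeasure μ) = μ := by
  rw [conjMeasure, conjMeasure, Measure.map_map measurable_circleConj measurable_circleConj,
    circleConj_involutive.comp_self, Measure.map_id]

/-! ### Antilinear isometric involutions -/

section Antiunitary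

variable {H : Type*} [NormedAddCommGroup H] [InnerProductSpace ℂ H]

/-- Polarization: antilinearity exchanges the terms ‖x + iy‖² and ‖x − iy‖², which flips the sign of
the imaginary part. -/
theorem inner_map_map_of_norm_map {C : H →L⋆[ℂ] H} (hC : ∀ x, ‖C x‖ = ‖x‖) (x y : H) :
    ⟪C x, C y⟫_ℂ = starRingEnd ℂ ⟪x, y⟫_ℂ := by
  have h1 : C (x - Complex.I • y) = C x + Complex.I • C y := by
    rw [map_sub, map_smulₛₗ, Complex.conj_I, neg_smul, sub_neg_eq_add]
  have h2 : C (x + Complex.I • y) = C x - Complex.I • C y := by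
    rw [map_add, map_smulₛₗ, Complex.conj_I, neg_smul, sub_eq_add_neg]
  rw [inner_eq_sum_norm_sq_div_four, inner_eq_sum_norm_sq_div_four, ← map_add, ← map_sub]
  simp only [RCLike.I_to_complex]
  rw [← h1, ← h2, hC, hC, hC, hC]
  have h4 : starRingEnd ℂ (4 : ℂ) = 4 := Complex.conj_ofNat 4
  simp [h4]
  ring

theorem image_eq_of_involutive {C : H →L⋆[ℂ] H} (hinv : ∀ x, C (C x) = x) {S T : Submodule ℂ H}
    (hST : ∀ x ∈ S, C x ∈ T) (hTS : ∀ x ∈ T, C x ∈ S) : C '' (S : Set H) = (T : Set H) :=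
  Set.Subset.antisymm (Set.image_subset_iff.2 hST) fun x hx => ⟨C x, hTS x hx, hinv x⟩

/-- Each y in T equals C(Cy) with Cy in S, so ⟨y, Cx⟩ is the conjugate of ⟨Cy, x⟩ = 0. The inclusion
needed is the one from T to S. -/
theorem map_mem_orthogonal {C : H →L⋆[ℂ] H} (hnorm : ∀ x, ‖C x‖ = ‖x‖)
    (hinv : ∀ x, C (C x) = x) {S T : Submodule ℂ H} (hTS : ∀ x ∈ T, C x ∈ S) {x : H}
    (hx : x ∈ Sᗮ) : C x ∈ Tᗮ := by
  intro y hy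
  rw [← hinv y, inner_map_map_of_norm_map hnorm, hx _ (hTS y hy), map_zero]

theorem exists_restrict_linearIsometryEquiv {C : H →L⋆[ℂ] H} (hnorm : ∀ x, ‖C x‖ = ‖x‖)
    (hinv : ∀ x, C (C x) = x) {S T : Submodule ℂ H} (hST : ∀ x ∈ S, C x ∈ T)
    (hTS : ∀ x ∈ T, C x ∈ S) : ∃ D : S ≃ₗᵢ⋆[ℂ] T, ∀ y, (D y : H) = C y := by
  let f : S →ₛₗᵢ[starRingEnd ℂ] T :=
    { toLinearMap := (C : H →ₛₗ[starRingEnd ℂ] H).restrict hST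
      norm_map' := fun y => hnorm y }
  exact ⟨LinearIsometryEquiv.ofSurjective f fun z => ⟨⟨C z, hTS z z.2⟩, Subtype.ext (hinv z)⟩,
    fun y => rfl⟩

end Antiunitary

/-! ### Conjugations acting on elementary measures and spectral subspaces -/

section
variable {H : Type*} [NormedAddCommGroup H] [InnerProductSpace ℂ H] [CompleteSpace H]

theorem commutingConjugations_map_pow {U : unitary (H →L[ℂ] H)} {C : H →L⋆[ℂ] H}
    (hC : C ∈ commutingConjugations U) (m : ℕ) (x : H) :
    ((U : H →L[ℂ] H) ^ m) (C x) = C (((U : H →L[ℂ] H) ^ m) x) := by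
  induction m generalizing x with
  | zero => simp
  | succ m ih =>
    have h : (U : H →L[ℂ] H) (C x) = C ((U : H →L[ℂ] H) x) := by
      rw [← hC.2.2 x, hC.2.1]
    rw [pow_succ, mul_apply_eq_comp, mul_apply_eq_comp, h, ih]

/-- C conjugates every moment of μ_x, and so does reflection of the circle. Comparing moments avoids
any appeal to uniqueness of the spectral measure. -/
theorem elementaryMeasure_commutingConjugation {E : SpectralMeasure H}
    {U : unitary (H →L[ℂ] H)} (hE : E.IsSpectralMeasureOf U) {C : H →L⋆[ℂ] H}
    (hC : C ∈ commutingConjugations U) (x : H) :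
    E.elementaryMeasure (C x) = conjMeasure (E.elementaryMeasure x) := by
  have hfin : IsFiniteMeasure (conjMeasure (E.elementaryMeasure x)) := by
    rw [conjMeasure]; infer_instance
  refine circle_measure_ext fun m => ?_
  rw [← hE.inner_map_pow, commutingConjugations_map_pow hC, inner_map_map_of_norm_map hC.1,
    hE.inner_map_pow, ← integral_conj, conjMeasure, integral_map
      measurable_circleConj.aemeasurable
      (Continuous.aestronglyMeasurable (by fun_prop))]
  refine integral_congr_ae (ae_of_all _ fun ξ => ?_)
  simp [circleConj]

theorem commutingConjugation_mem_spectralSubspace {U : unitary (H →L[ℂ] H)} {C : H →L⋆[ℂ] H}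
    (hC : C ∈ commutingConjugations U) {μ : Measure Circle} {x : H}
    (hx : x ∈ spectralSubspace U μ) : C x ∈ spectralSubspace U (conjMeasure μ) := by
  change (spectralMeasure U).elementaryMeasure (C x) ≪ conjMeasure μ
  rw [elementaryMeasure_commutingConjugation (spectralMeasure_spec U) hC]
  exact Measure.AbsolutelyContinuous.map hx measurable_circleConj

/-- H_μ is the intersection of the kernels of E(Ω) over the μ-null Borel sets Ω. Closedness is what
makes the orthogonal decomposition of H available. -/
theorem isClosed_spectralSubspace (U : unitary (H →L[ℂ] H)) (μ : Measure Circle) :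
    IsClosed (spectralSubspace U μ : Set H) := by
  have h : (spectralSubspace U μ : Set H)
      = ⋂ (Ω : Set Circle) (_ : MeasurableSet Ω) (_ : μ Ω = 0),
        {x | (spectralMeasure U).proj Ω x = 0} := by
    ext x
    simp only [Set.mem_iInter, Set.mem_ofPred_eq]
    exact (spectralMeasure U).elementaryMeasure_absolutelyContinuous_iff x μ
  rw [h]
  exact isClosed_iInter fun Ω => isClosed_iInter fun _ => isClosed_iInter fun _ =>
    isClosed_eq ((spectralMeasure U).proj Ω).continuous continuous_const

theorem isCompl_spectralSubspace_orthogonal (U : unitary (H →L[ℂ] H)) (μ : Measure Circle) :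
    IsCompl (spectralSubspace U μ) (spectralSubspace U μ)ᗮ := by
  have : CompleteSpace (spectralSubspace U μ) :=
    (isClosed_spectralSubspace U μ).completeSpace_coe
  exact Submodule.isCompl_orthogonal (K := spectralSubspace U μ)

end

theorem mainTheorem8 {H : Type*} [NormedAddCommGroup H] [InnerProductSpace ℂ H] [CompleteSpace H]
    (U : unitary (H →L[ℂ] H)) (μ : Measure Circle) [IsFiniteMeasure μ]
    (C : H →L⋆[ℂ] H) (hC : C ∈ commutingConjugations U) :
    (C '' (spectralSubspace U μ : Set H) = (spectralSubspace U (conjMeasure μ) : Set H) ∧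
      C '' ((spectralSubspace U μ)ᗮ : Set H) = ((spectralSubspace U (conjMeasure μ))ᗮ : Set H)) ∧
    (IsCompl (spectralSubspace U μ) (spectralSubspace U μ)ᗮ ∧
      IsCompl (spectralSubspace U (conjMeasure μ)) (spectralSubspace U (conjMeasure μ))ᗮ ∧
      ∃ (C₁ : spectralSubspace U μ ≃ₗᵢ⋆[ℂ] spectralSubspace U (conjMeasure μ))
        (C₂ : (spectralSubspace U μ)ᗮ ≃ₗᵢ⋆[ℂ] (spectralSubspace U (conjMeasure μ))ᗮ),
        (∀ y, (C₁ y : H) = C y) ∧ (∀ z, (C₂ z : H) = C z) ∧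
        ∀ (y : spectralSubspace U μ) (z : (spectralSubspace U μ)ᗮ),
          C ((y : H) + (z : H)) = (C₁ y : H) + (C₂ z : H)) := by
  have h1 : ∀ x ∈ spectralSubspace U μ, C x ∈ spectralSubspace U (conjMeasure μ) :=
    fun x hx => commutingConjugation_mem_spectralSubspace hC hx
  -- The forward inclusion applied to μ^c, since (μ^c)^c = μ.
  have h2 : ∀ x ∈ spectralSubspace U (conjMeasure μ), C x ∈ spectralSubspace U μ := fun x hx => by
    simpa only [conjMeasure_conjMeasure] using commutingConjugation_mem_spectralSubspace hC hx
  have h3 : ∀ x ∈ (spectralSubspace U μ)ᗮ, C x ∈ (spectralSubspace U (conjMeasure μ))ᗮ :=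
    fun x hx => map_mem_orthogonal hC.1 hC.2.1 h2 hx
  have h4 : ∀ x ∈ (spectralSubspace U (conjMeasure μ))ᗮ, C x ∈ (spectralSubspace U μ)ᗮ :=
    fun x hx => map_mem_orthogonal hC.1 hC.2.1 h1 hx
  obtain ⟨C₁, hC₁⟩ := exists_restrict_linearIsometryEquiv hC.1 hC.2.1 h1 h2
  obtain ⟨C₂, hC₂⟩ := exists_restrict_linearIsometryEquiv hC.1 hC.2.1 h3 h4
  exact ⟨⟨image_eq_of_involutive hC.2.1 h1 h2, image_eq_of_involutive hC.2.1 h3 h4⟩,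
    isCompl_spectralSubspace_orthogonal U μ, isCompl_spectralSubspace_orthogonal U _,
    C₁, C₂, hC₁, hC₂, fun y z => by rw [map_add, hC₁, hC₂]⟩
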